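/- There is an absolute constant $C$ such that the following holds. Let $d\ge 1$ and $L$ be natural numbers and let $p\in\mathbb{Z}[x]$ be a polynomial of degree $d$ that is square-free (in $\mathbb{Q}[x]$, i.e. without multiple complex roots) and all of whose coefficients have absolute value less than $2^L$. Run the complex Sturm bisection algorithm for $p$ on the benchmark square $[-2^L,2^L]\times[-2^L i,2^L i]\subset\mathbb{C}$: a square that contains at most one complex root of $p$ is terminal, and every other square is split into four congruent squares, to which the same test is applied. Then the algorithm terminates, and its subdivision quadtree (all nodes, internal nodes and leaves, counted) has size at most $C\,d\,(L+\ln d)$; that is, the size is $O(d(L+\ln d))$. This holds both if the roots are counted in the half-open squares $[a,b)\times(ci,ei]$ and if they are counted in the closed squares $[a,b]\times[ci,ei]$. -/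

import Mathlib

open Polynomial
open scoped Complex

/-- An axis-aligned square in the complex plane, given by its lower left corner `a + c i` and its
side length `w`. -/
structure Square where
  a : ℝ
  c : ℝ
  w : ℝ
  w_pos : 0 < w

namespace Square

/-- The closed square `[a, a + w] × [c i, (c + w) i]`. -/
def closedRegion (S : Square) : Set ℂ :=
  Set.Icc S.a (S.a + S.w) ×ℂ Set.Icc S.c (S.c + S.w)

/-- The half-open square `[a, a + w) × (c i, (c + w) i]`. -/
def halfOpenRegion (S : Square) : Set ℂ :=
  Set.Ico S.a (S.a + S.w) ×ℂ Set.Ioc S.c (S.c + S.w)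

/-- The four squares obtained from `S` by bisecting both of its sides: `i` selects the left or the
right half, `j` the lower or the upper half. -/
noncomputable def child (S : Square) (i j : Fin 2) : Square where
  a := S.a + (i : ℕ) * (S.w / 2)
  c := S.c + (j : ℕ) * (S.w / 2)
  w := S.w / 2
  w_pos := half_pos S.w_pos

/-- The benchmark square `[-2^L, 2^L] × [-2^L i, 2^L i]`. -/
noncomputable def benchmark (L : ℕ) : Square where
  a := -2 ^ L
  c := -2 ^ L
  w := 2 ^ (L + 1)
  w_pos := by positivity

theorem benchmark_closedRegion (L : ℕ) :
    (benchmark L).closedRegion =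
      Set.Icc (-2 ^ L : ℝ) (2 ^ L) ×ℂ Set.Icc (-2 ^ L : ℝ) (2 ^ L) := by
  have h : (-2 ^ L + 2 ^ (L + 1) : ℝ) = 2 ^ L := by ring
  simp only [closedRegion, benchmark, h]

end Square

/-- Finite quadtrees: every internal node has exactly four children. -/
inductive QuadTree : Type
  | leaf : QuadTree
  | node (t : Fin 2 → Fin 2 → QuadTree) : QuadTree

/-- The size of a quadtree: the number of all its nodes, internal nodes and leaves. -/
def QuadTree.size : QuadTree → ℕ
  | .leaf => 1
  | .node t => 1 + ∑ i, ∑ j, (t i j).size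

/-- `SubdivisionTree B S T`: the bisection algorithm with the predicate `B`, started on the square
`S`, terminates, and `T` is its subdivision tree. A square on which `B` is true is terminal; a
square on which `B` is false is bisected and the algorithm continues with its four children. -/
inductive SubdivisionTree (B : Square → Prop) : Square → QuadTree → Prop
  | terminal {S : Square} : B S → SubdivisionTree B S .leaf
  | bisect {S : Square} {t : Fin 2 → Fin 2 → QuadTree} :
      ¬ B S → (∀ i j, SubdivisionTree B (S.child i j) (t i j)) → SubdivisionTree B S (.node t)

/-- The algorithm is deterministic: it has at most one subdivision tree. -/
theorem SubdivisionTree.unique {B : Square → Prop} {S : Square} {T T' : QuadTree}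
    (h : SubdivisionTree B S T) (h' : SubdivisionTree B S T') : T = T' := by
  induction h generalizing T' with
  | terminal hB =>
    cases h' with
    | terminal _ => rfl
    | bisect hn _ => exact absurd hB hn
  | bisect hn _ ih =>
    cases h' with
    | terminal hB => exact absurd hB hn
    | bisect _ hc =>
      congr 1
      funext i j
      exact ih i j (hc i j)

/-- The complex Sturm predicate, with the roots counted in the half-open square: it is true if the
square contains 0 or 1 roots of `p`, and false if it contains 2 or more. -/
def CSturm (p : ℤ[X]) (S : Square) : Prop :=
  (p.rootSet ℂ ∩ S.halfOpenRegion).ncard ≤ 1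

/-- The complex Sturm predicate, with the roots counted in the closed square. -/
def CSturmClosed (p : ℤ[X]) (S : Square) : Prop :=
  (p.rootSet ℂ ∩ S.closedRegion).ncard ≤ 1

/-! A square that is split contains two roots in its closure, hence a root whose distance to its
nearest neighbour is at most twice the side. Charging the split to that root makes the tree size an
amortized cost: give each root the number of levels at which it can still pay (`splitDepth`),
weighted by a multiplicity that is additive under bisection, so that roots on common sides are not
overcounted (`exists_subdivisionTree_size_le`). The size is then O(dL) plus a constant times the sum
of the positive parts of -log σ, where σ is the distance to the nearest root.

That sum is O(d(L + log d)) by a Davenport–Mahler argument. The discriminant is a nonzero integer,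
which bounds the Vandermonde determinant of the roots below. Subtracting rows of close roots factors
their differences out of the determinant, and the remaining factor is bounded through the Mahler
measure. So the product of close distances cannot be too small (`sum_neg_log_norm_sub_le`). -/

/-! ### Additive counting of points in closed squares -/

/-- The number of half-open intervals among `[a, a + w)` and `(a, a + w]` that contain `x`. -/
noncomputable def endpointCount (a w x : ℝ) : ℝ :=
  (if x ∈ Set.Ico a (a + w) then 1 else 0) + (if x ∈ Set.Ioc a (a + w) then 1 else 0)

theorem endpointCount_nonneg (a w x : ℝ) : 0 ≤ endpointCount a w x := by
  unfold endpointCount; split_ifs <;> norm_num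

theorem endpointCount_le_two (a w x : ℝ) : endpointCount a w x ≤ 2 := by
  unfold endpointCount; split_ifs <;> norm_num

theorem one_le_endpointCount {a w x : ℝ} (hw : 0 < w) (hx : x ∈ Set.Icc a (a + w)) :
    1 ≤ endpointCount a w x := by
  unfold endpointCount
  rcases hx.1.eq_or_lt with h | h
  · rw [if_pos (by constructor <;> linarith)]; split_ifs <;> norm_num
  · rw [if_pos (c := x ∈ Set.Ioc a (a + w)) ⟨h, hx.2⟩]; split_ifs <;> norm_num

theorem endpointCount_bisect {a w : ℝ} (hw : 0 < w) (x : ℝ) :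
    endpointCount a (w / 2) x + endpointCount (a + w / 2) (w / 2) x = endpointCount a w x := by
  have e : a + w / 2 + w / 2 = a + w := by ring
  simp only [endpointCount, Set.mem_Ico, Set.mem_Ioc, e]
  have h1 : (if a ≤ x ∧ x < a + w / 2 then (1 : ℝ) else 0) +
      (if a + w / 2 ≤ x ∧ x < a + w then 1 else 0) = if a ≤ x ∧ x < a + w then 1 else 0 := by
    split_ifs <;> grind
  have h2 : (if a < x ∧ x ≤ a + w / 2 then (1 : ℝ) else 0) +
      (if a + w / 2 < x ∧ x ≤ a + w then 1 else 0) = if a < x ∧ x ≤ a + w then 1 else 0 := by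
    split_ifs <;> grind
  rw [← h1, ← h2]; ring

namespace Square

/-- The multiplicity with which a point is counted in a closed square: `4` in the interior, `2` on
the sides, `1` at the corners and `0` outside. It is additive under bisection. -/
noncomputable def multiplicity (S : Square) (z : ℂ) : ℝ :=
  endpointCount S.a S.w z.re * endpointCount S.c S.w z.im

theorem multiplicity_nonneg (S : Square) (z : ℂ) : 0 ≤ S.multiplicity z :=
  mul_nonneg (endpointCount_nonneg _ _ _) (endpointCount_nonneg _ _ _)

theorem multiplicity_le_four (S : Square) (z : ℂ) : S.multiplicity z ≤ 4 := by
  have := mul_le_mul (endpointCount_le_two S.a S.w z.re) (endpointCount_le_two S.c S.w z.im)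
    (endpointCount_nonneg _ _ _) zero_le_two
  unfold multiplicity; linarith

theorem one_le_multiplicity {S : Square} {z : ℂ} (hz : z ∈ S.closedRegion) :
    1 ≤ S.multiplicity z :=
  one_le_mul_of_one_le_of_one_le (one_le_endpointCount S.w_pos hz.1)
    (one_le_endpointCount S.w_pos hz.2)

theorem sum_multiplicity_child (S : Square) (z : ℂ) :
    ∑ i, ∑ j, (S.child i j).multiplicity z = S.multiplicity z := by
  simp only [multiplicity, child, Fin.sum_univ_two, Fin.val_zero, Fin.val_one, Nat.cast_zero,
    Nat.cast_one, zero_mul, one_mul, add_zero, ← endpointCount_bisect S.w_pos]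
  ring

theorem norm_sub_le_two_mul {S : Square} {z z' : ℂ} (hz : z ∈ S.closedRegion)
    (hz' : z' ∈ S.closedRegion) : ‖z - z'‖ ≤ 2 * S.w := by
  obtain ⟨⟨h1, h2⟩, h3, h4⟩ := hz
  obtain ⟨⟨h5, h6⟩, h7, h8⟩ := hz'
  refine (Complex.norm_le_abs_re_add_abs_im _).trans ?_
  have h9 : |(z - z').re| ≤ S.w := by rw [Complex.sub_re, abs_le]; constructor <;> linarith
  have h10 : |(z - z').im| ≤ S.w := by rw [Complex.sub_im, abs_le]; constructor <;> linarith
  linarith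

theorem halfOpenRegion_subset_closedRegion (S : Square) :
    S.halfOpenRegion ⊆ S.closedRegion :=
  fun _ hz => ⟨Set.Ico_subset_Icc_self hz.1, Set.Ioc_subset_Icc_self hz.2⟩

end Square

/-! ### Amortized size of the subdivision tree -/

/-- A bound for the number of successive bisections of a square of side length `w` after which a
closed square can still contain two points at distance `s`. -/
noncomputable def splitDepth (w s : ℝ) : ℝ := max 0 (Real.logb 2 (4 * w / s))

theorem splitDepth_nonneg (w s : ℝ) : 0 ≤ splitDepth w s := le_max_left _ _

theorem splitDepth_half_le {w s : ℝ} (hw : 0 < w) (hs : 0 < s) :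
    splitDepth (w / 2) s ≤ splitDepth w s := by
  unfold splitDepth
  gcongr
  · norm_num
  · linarith

/-- The factor 4 in `splitDepth` keeps the logarithm nonnegative after halving when `s ≤ 2 * w`, so
the truncation at 0 does not absorb the unit that pays for the split. -/
theorem splitDepth_half_add_one_le {w s : ℝ} (hw : 0 < w) (hs : 0 < s) (h : s ≤ 2 * w) :
    splitDepth (w / 2) s + 1 ≤ splitDepth w s := by
  have e : Real.logb 2 (4 * w / s) = Real.logb 2 (4 * (w / 2) / s) + 1 := by
    rw [show 4 * w / s = 4 * (w / 2) / s * 2 by ring, Real.logb_mul (by positivity) two_ne_zero,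
      Real.logb_self_eq_one one_lt_two]
  have h0 : 0 ≤ Real.logb 2 (4 * (w / 2) / s) :=
    Real.logb_nonneg one_lt_two (by rw [le_div_iff₀ hs]; linarith)
  unfold splitDepth
  rw [e, max_eq_right h0]
  exact le_max_right _ _

/-- The amortized bound for bisection of squares with a predicate that accepts every closed square
with at most one of the points `α v`, where `σ v` bounds the distance of `α v` to the others from
below. -/
theorem exists_subdivisionTree_size_le {ι : Type*} [Fintype ι] (α : ι → ℂ) (σ : ι → ℝ)
    (hσ : ∀ v, 0 < σ v) (hsep : ∀ u v, α u ≠ α v → σ v ≤ ‖α v - α u‖) (B : Square → Prop)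
    (hB : ∀ S : Square, (Set.range α ∩ S.closedRegion).ncard ≤ 1 → B S) (n : ℕ) (S : Square)
    (hn : ∀ v, 2 * S.w < 2 ^ n * σ v) :
    ∃ T : QuadTree, SubdivisionTree B S T ∧
      (T.size : ℝ) ≤ 1 + 4 * ∑ v, S.multiplicity (α v) * splitDepth S.w (σ v) := by
  induction n generalizing S with
  | zero =>
    refine ⟨.leaf, .terminal (hB S ?_), ?_⟩
    · rw [Set.ncard_le_one ((Set.finite_range α).inter_of_left _)]
      rintro _ ⟨⟨u, rfl⟩, hu⟩ _ ⟨⟨v, rfl⟩, hv⟩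
      by_contra hne
      have := hsep u v hne
      have := Square.norm_sub_le_two_mul hv hu
      have := hn v
      linarith
    · have : 0 ≤ ∑ v, S.multiplicity (α v) * splitDepth S.w (σ v) :=
        Finset.sum_nonneg fun v _ => mul_nonneg (S.multiplicity_nonneg _) (splitDepth_nonneg _ _)
      simp only [QuadTree.size, Nat.cast_one]
      linarith
  | succ n ih =>
    by_cases hS : B S
    · refine ⟨.leaf, .terminal hS, ?_⟩
      have : 0 ≤ ∑ v, S.multiplicity (α v) * splitDepth S.w (σ v) :=
        Finset.sum_nonneg fun v _ => mul_nonneg (S.multiplicity_nonneg _) (splitDepth_nonneg _ _)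
      simp only [QuadTree.size, Nat.cast_one]
      linarith
    · have hchild (i j : Fin 2) : ∀ v, 2 * (S.child i j).w < 2 ^ n * σ v := fun v => by
        have := hn v
        simp only [Square.child]
        rw [pow_succ] at this
        linarith
      choose t ht hsize using fun i j => ih (S.child i j) (hchild i j)
      refine ⟨.node t, .bisect hS ht, ?_⟩
      -- The root that pays: its potential drops by its multiplicity, which is at least 1, and no
      -- other potential grows.
      obtain ⟨v₀, hv₀, hle⟩ : ∃ v₀, α v₀ ∈ S.closedRegion ∧ σ v₀ ≤ 2 * S.w := by
        have h2 : ¬ (Set.range α ∩ S.closedRegion).ncard ≤ 1 := fun h => hS (hB S h)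
        rw [Set.ncard_le_one ((Set.finite_range α).inter_of_left _)] at h2
        push Not at h2
        obtain ⟨_, ⟨⟨u, rfl⟩, hu⟩, _, ⟨⟨v, rfl⟩, hv⟩, hne⟩ := h2
        exact ⟨v, hv, (hsep u v hne).trans (Square.norm_sub_le_two_mul hv hu)⟩
      have hsum : ∑ i, ∑ j, ∑ v, (S.child i j).multiplicity (α v) *
            splitDepth (S.child i j).w (σ v) =
          ∑ v, S.multiplicity (α v) * splitDepth (S.w / 2) (σ v) := by
        have : ∀ v, S.multiplicity (α v) * splitDepth (S.w / 2) (σ v) =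
            ∑ i, ∑ j, (S.child i j).multiplicity (α v) * splitDepth (S.w / 2) (σ v) := fun v => by
          simp only [← Finset.sum_mul, Square.sum_multiplicity_child]
        simp only [this, Square.child, Fin.sum_univ_two, Finset.sum_add_distrib]
      have hstep : 1 + ∑ v, S.multiplicity (α v) * splitDepth (S.w / 2) (σ v) ≤
          ∑ v, S.multiplicity (α v) * splitDepth S.w (σ v) := by
        classical
        rw [← Finset.add_sum_erase _ _ (Finset.mem_univ v₀),
          ← Finset.add_sum_erase _ (fun v => S.multiplicity (α v) * splitDepth S.w (σ v))
            (Finset.mem_univ v₀), ← add_assoc]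
        refine add_le_add ?_ (Finset.sum_le_sum fun v _ => mul_le_mul_of_nonneg_left
          (splitDepth_half_le S.w_pos (hσ v)) (S.multiplicity_nonneg _))
        have h1 := Square.one_le_multiplicity hv₀
        have h2 := splitDepth_half_add_one_le S.w_pos (hσ v₀) hle
        nlinarith [mul_le_mul_of_nonneg_left h2 (S.multiplicity_nonneg (α v₀))]
      have hle4 : ∑ i, ∑ j, ((t i j).size : ℝ) ≤ ∑ i : Fin 2, ∑ j : Fin 2,
          (1 + 4 * ∑ v, (S.child i j).multiplicity (α v) * splitDepth (S.child i j).w (σ v)) :=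
        Finset.sum_le_sum fun i _ => Finset.sum_le_sum fun j _ => hsize i j
      have hcount : ∑ i : Fin 2, ∑ j : Fin 2,
          (1 + 4 * ∑ v, (S.child i j).multiplicity (α v) * splitDepth (S.child i j).w (σ v)) =
          4 * (1 + ∑ v, S.multiplicity (α v) * splitDepth (S.w / 2) (σ v)) := by
        rw [← hsum]
        simp only [Fin.sum_univ_two]
        ring
      simp only [QuadTree.size, Nat.cast_add, Nat.cast_one, Nat.cast_sum]
      linarith

/-! ### Discriminant and Mahler measure -/

theorem exists_injective_enumeration_of_nodup {R : Type*} {s : Multiset R} {d : ℕ}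
    (hs : s.Nodup) (hd : s.card = d) :
    ∃ α : Fin d → R, Function.Injective α ∧ s = Finset.univ.val.map α := by
  subst hd
  have e : s = Finset.univ.val.map fun i : Fin s.card => s.toList.get (i.cast (by simp)) := by
    rw [Fin.univ_val_map]
    conv_lhs => rw [← s.coe_toList]
    congr 1
    apply List.ext_get <;> simp
  refine ⟨_, ?_, e⟩
  exact fun i j h => Multiset.inj_on_of_nodup_map (e ▸ hs) i (Finset.mem_univ_val _) j
    (Finset.mem_univ_val _) h

theorem sq_det_vandermonde_norm {d : ℕ} (α : Fin d → ℂ) :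
    ∏ i, ∏ j ∈ Finset.univ.erase i, ‖α i - α j‖ = ‖(Matrix.vandermonde α).det‖ ^ 2 := by
  have h := Finset.prod_prod_Ioi_mul_eq_prod_prod_off_diag fun i j => ‖α j - α i‖
  simp only [Finset.compl_singleton] at h
  rw [← h, Matrix.det_vandermonde, norm_prod, ← Finset.prod_pow]
  refine Finset.prod_congr rfl fun i _ => ?_
  rw [norm_prod, ← Finset.prod_pow]
  refine Finset.prod_congr rfl fun j _ => ?_
  rw [norm_sub_rev (α i) (α j), sq]

theorem eval_derivative_eq_leadingCoeff_mul_prod {q : ℂ[X]} {d : ℕ} {α : Fin d → ℂ}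
    (hα : q.roots = Finset.univ.val.map α) (i : Fin d) :
    (derivative q).eval (α i) = q.leadingCoeff * ∏ j ∈ Finset.univ.erase i, (α i - α j) := by
  have hq : q = C q.leadingCoeff * ∏ j, (X - C (α j)) := by
    conv_lhs => rw [(IsAlgClosed.splits q).eq_prod_roots, hα, Multiset.map_map]
    rfl
  rw [hq]
  simp only [derivative_C_mul, leadingCoeff_mul, leadingCoeff_C, leadingCoeff_prod,
    leadingCoeff_X_sub_C, Finset.prod_const_one, mul_one, eval_mul, eval_C]
  rw [derivative_prod_finset]
  simp only [derivative_X_sub_C, eval_finsetSum, mul_one]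
  rw [Finset.sum_eq_single i]
  · simp [eval_prod]
  · intro b _ hb
    rw [eval_prod]
    exact Finset.prod_eq_zero (i := i) (by simp [hb.symm]) (by simp)
  · simp

/-- The right-hand side is the absolute value of the resultant of `p` and its derivative, an integer
that is nonzero because the roots are distinct. -/
theorem one_le_leadingCoeff_pow_mul_sq_det_vandermonde {p : ℤ[X]} {d : ℕ} {α : Fin d → ℂ}
    (hd : p.natDegree = d) (hp : p ≠ 0) (hinj : Function.Injective α)
    (hα : (p.map (Int.castRingHom ℂ)).roots = Finset.univ.val.map α) :
    1 ≤ |(p.leadingCoeff : ℝ)| ^ (d - 1 + d) * ‖(Matrix.vandermonde α).det‖ ^ 2 := by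
  set q := p.map (Int.castRingHom ℂ) with hq
  have hinjZ : Function.Injective (Int.castRingHom ℂ) := Int.cast_injective
  have hqd : q.natDegree = d := by rw [hq, natDegree_map_eq_of_injective hinjZ, hd]
  have hlc : q.leadingCoeff = (p.leadingCoeff : ℂ) := by
    rw [hq, leadingCoeff_map_of_injective hinjZ]; rfl
  have hres : ((p.resultant (derivative p) d (d - 1) : ℤ) : ℂ) =
      q.leadingCoeff ^ (d - 1) *
        ∏ i, (q.leadingCoeff * ∏ j ∈ Finset.univ.erase i, (α i - α j)) := by
    have h1 := resultant_map_map p (derivative p) d (d - 1) (Int.castRingHom ℂ)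
    have h2 := resultant_eq_prod_eval q (derivative q) (d - 1)
      ((natDegree_derivative_le q).trans (by rw [hqd])) (IsAlgClosed.splits q)
    rw [hqd] at h2
    rw [← derivative_map, ← hq, h2, hα] at h1
    rw [← eq_intCast (Int.castRingHom ℂ), ← h1, Multiset.map_map]
    congr 1
    exact Finset.prod_congr rfl fun i _ => eval_derivative_eq_leadingCoeff_mul_prod hα i
  have hnorm : |(p.resultant (derivative p) d (d - 1) : ℝ)| =
      |(p.leadingCoeff : ℝ)| ^ (d - 1 + d) * ‖(Matrix.vandermonde α).det‖ ^ 2 := by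
    rw [← sq_det_vandermonde_norm, ← Complex.norm_intCast, hres]
    simp only [hlc, norm_mul, norm_pow, norm_prod, Finset.prod_mul_distrib, Finset.prod_const,
      Finset.card_univ, Fintype.card_fin, Complex.norm_intCast]
    ring
  rw [← hnorm]
  have hne : p.resultant (derivative p) d (d - 1) ≠ 0 := by
    intro h0
    rw [h0, Int.cast_zero, abs_zero, eq_comm, mul_eq_zero] at hnorm
    rcases hnorm with h | h
    · have h3 := eq_zero_of_pow_eq_zero h
      simp [hp] at h3
    · exact Matrix.det_vandermonde_ne_zero_iff.2 hinj (norm_eq_zero.1 (eq_zero_of_pow_eq_zero h))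
  exact_mod_cast Int.one_le_abs hne

/-- The left-hand side is the Mahler measure, which is at most the sum of the absolute values of the
coefficients. -/
theorem prod_max_one_norm_le {p : ℤ[X]} {d L : ℕ} {α : Fin d → ℂ} (hd : p.natDegree = d)
    (hL : ∀ k, |p.coeff k| < 2 ^ L)
    (hα : (p.map (Int.castRingHom ℂ)).roots = Finset.univ.val.map α) :
    |(p.leadingCoeff : ℝ)| * ∏ i, max 1 ‖α i‖ ≤ (d + 1) * 2 ^ L := by
  have hinjZ : Function.Injective (Int.castRingHom ℂ) := Int.cast_injective
  have h := mahlerMeasure_eq_leadingCoeff_mul_prod_roots (p.map (Int.castRingHom ℂ))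
  rw [hα, leadingCoeff_map_of_injective hinjZ, Multiset.map_map, eq_intCast,
    Complex.norm_intCast] at h
  refine h.symm.trans_le ((mahlerMeasure_le_sum_norm_coeff _).trans ?_)
  rw [sum_over_range _ (by simp), natDegree_map_eq_of_injective hinjZ, hd]
  have : ∀ i ∈ Finset.range (d + 1), ‖(p.map (Int.castRingHom ℂ)).coeff i‖ ≤ 2 ^ L := by
    intro i _
    rw [coeff_map, eq_intCast, Complex.norm_intCast]
    exact_mod_cast (hL i).le
  refine (Finset.sum_le_card_nsmul _ _ _ this).trans ?_
  simp

/-! ### Upper bound for the Vandermonde determinant -/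

/-- Leibniz expansion; it is cruder than Hadamard's inequality, but log n! costs only O(n log n). -/
theorem Matrix.norm_det_le_factorial_mul_prod {n : ℕ} (A : Matrix (Fin n) (Fin n) ℂ)
    (r : Fin n → ℝ) (h : ∀ i j, ‖A i j‖ ≤ r i) : ‖A.det‖ ≤ n.factorial * ∏ i, r i := by
  rw [Matrix.det_apply]
  refine (norm_sum_le _ _).trans ?_
  have : ∀ σ ∈ (Finset.univ : Finset (Equiv.Perm (Fin n))),
      ‖Equiv.Perm.sign σ • ∏ i, A (σ i) i‖ ≤ ∏ i, r i := by
    intro σ _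
    rw [Units.smul_def, norm_zsmul ℂ]
    have hs : ‖((Equiv.Perm.sign σ : ℤ) : ℂ)‖ = 1 := by
      rcases Int.units_eq_one_or (Equiv.Perm.sign σ) with h | h <;> simp [h]
    rw [hs, one_mul, norm_prod, ← Equiv.prod_comp σ r]
    exact Finset.prod_le_prod (fun _ _ => norm_nonneg _) fun i _ => h _ _
  refine (Finset.sum_le_card_nsmul _ _ _ this).trans ?_
  simp [Fintype.card_perm]

/-- Row operations on the Vandermonde matrix that replace the rows `v ∈ A` by divided
differences. The unipotent matrix of the row operations is `U`. -/
theorem Matrix.norm_det_vandermonde_le_of_close {d : ℕ} (hd : 1 ≤ d) (α : Fin d → ℂ)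
    (f : Fin d → Fin d) (A : Finset (Fin d))
    (hU : (Matrix.of fun i j => (if i = j then (1 : ℂ) else 0) - if i ∈ A ∧ j = f i then 1 else 0 :
      Matrix (Fin d) (Fin d) ℂ).det = 1)
    (hclose : ∀ v ∈ A, ‖α v - α (f v)‖ ≤ 1 / d) :
    ‖(Matrix.vandermonde α).det‖ ≤
      d.factorial * ((3 * d) ^ d * (∏ v, max 1 ‖α v‖) ^ (d - 1)) *
        ∏ v ∈ A, ‖α v - α (f v)‖ := by
  classical
  set U : Matrix (Fin d) (Fin d) ℂ :=
    Matrix.of fun i j => (if i = j then (1 : ℂ) else 0) - if i ∈ A ∧ j = f i then 1 else 0 with hUdef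
  set W : Matrix (Fin d) (Fin d) ℂ := Matrix.of fun i j =>
    if i ∈ A then ∑ k ∈ Finset.range j, α i ^ k * α (f i) ^ (j - 1 - k : ℕ) else α i ^ (j : ℕ) with hW
  have hdet : (Matrix.vandermonde α).det =
      (∏ v, if v ∈ A then α v - α (f v) else 1) * W.det := by
    have hV : (U * Matrix.vandermonde α).det = (Matrix.vandermonde α).det := by
      rw [Matrix.det_mul, hU, one_mul]
    rw [← Matrix.det_mul_column, ← hV]
    congr 1
    ext i j
    simp only [hUdef, hW, Matrix.mul_apply, Matrix.of_apply, Matrix.vandermonde_apply, sub_mul,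
      Finset.sum_sub_distrib, ite_mul, one_mul, zero_mul, Finset.sum_ite_eq, Finset.mem_univ, if_true]
    by_cases hi : i ∈ A
    · simp only [hi, true_and, Finset.sum_ite_eq', Finset.mem_univ, if_true]
      rw [← sub_mul, mul_comm, (Commute.all (α i) (α (f i))).geom_sum₂_mul]
    · simp [hi]
  have hd0 : (0 : ℝ) < d := by exact_mod_cast hd
  have hentry : ∀ i j, ‖W i j‖ ≤ 3 * d * max 1 ‖α i‖ ^ (d - 1) := by
    intro i j
    have hm : (1 : ℝ) ≤ max 1 ‖α i‖ := le_max_left _ _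
    have hj : (j : ℕ) ≤ d - 1 := by omega
    have hpow : ∀ k ≤ d - 1, ‖α i‖ ^ k ≤ max 1 ‖α i‖ ^ k := fun k _ =>
      pow_le_pow_left₀ (norm_nonneg _) (le_max_right _ _) _
    have hone : (1 : ℝ) ≤ d := by exact_mod_cast hd
    simp only [hW, Matrix.of_apply]
    split_ifs with hi
    -- Closeness within 1/d lets the row be bounded by its own root alone: the factor 1 + 1/d,
    -- raised to a power below d, stays under e < 3.
    · have hf : ‖α (f i)‖ ≤ max 1 ‖α i‖ * (1 + 1 / d) := by
        have h1 := norm_sub_norm_le (α (f i)) (α i)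
        rw [norm_sub_rev] at h1
        have h2 := hclose i hi
        have h3 : ‖α i‖ ≤ max 1 ‖α i‖ := le_max_right _ _
        have h4 : 1 / (d : ℝ) ≤ max 1 ‖α i‖ * (1 / d) := le_mul_of_one_le_left (by positivity) hm
        linarith
      have hexp : (1 + 1 / (d : ℝ)) ^ (d - 1) ≤ 3 := by
        have h1 : (1 + 1 / (d : ℝ)) ^ (d - 1) ≤ (1 + 1 / (d : ℝ)) ^ d :=
          pow_le_pow_right₀ (by have : 0 < 1 / (d : ℝ) := by positivity
                                linarith) (Nat.sub_le _ _)
        have h2 : (1 + 1 / (d : ℝ)) ^ d ≤ Real.exp (1 / d) ^ d := by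
          gcongr
          linarith [Real.add_one_le_exp (1 / (d : ℝ))]
        rw [← Real.exp_nat_mul, mul_one_div_cancel hd0.ne'] at h2
        linarith [Real.exp_one_lt_d9]
      have hterm : ∀ k ∈ Finset.range j, ‖α i ^ k * α (f i) ^ (j - 1 - k : ℕ)‖ ≤
          3 * max 1 ‖α i‖ ^ (d - 1) := by
        intro k hk
        rw [Finset.mem_range] at hk
        rw [norm_mul, norm_pow, norm_pow]
        calc ‖α i‖ ^ k * ‖α (f i)‖ ^ (j - 1 - k : ℕ)
            ≤ max 1 ‖α i‖ ^ k * (max 1 ‖α i‖ * (1 + 1 / d)) ^ (j - 1 - k : ℕ) := by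
              gcongr
              exact le_max_right _ _
          _ = max 1 ‖α i‖ ^ (j - 1 : ℕ) * (1 + 1 / (d : ℝ)) ^ (j - 1 - k : ℕ) := by
              rw [mul_pow, ← mul_assoc, ← pow_add]
              congr 3
              omega
          _ ≤ max 1 ‖α i‖ ^ (d - 1) * (1 + 1 / (d : ℝ)) ^ (d - 1) := by
              have : (1 : ℝ) ≤ 1 + 1 / d := by
                have : 0 < 1 / (d : ℝ) := by positivity
                linarith
              exact mul_le_mul (pow_le_pow_right₀ hm (by omega)) (pow_le_pow_right₀ this (by omega))
                (by positivity) (by positivity)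
          _ ≤ max 1 ‖α i‖ ^ (d - 1) * 3 := by gcongr
          _ = _ := mul_comm _ _
      refine (norm_sum_le _ _).trans ((Finset.sum_le_card_nsmul _ _ _ hterm).trans ?_)
      rw [Finset.card_range, nsmul_eq_mul]
      have hjd : ((j : ℕ) : ℝ) ≤ d := by exact_mod_cast j.2.le
      calc ((j : ℕ) : ℝ) * (3 * max 1 ‖α i‖ ^ (d - 1)) ≤ d * (3 * max 1 ‖α i‖ ^ (d - 1)) := by
            gcongr
        _ = _ := by ring
    · rw [norm_pow]
      calc ‖α i‖ ^ (j : ℕ) ≤ max 1 ‖α i‖ ^ (j : ℕ) := hpow _ hj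
        _ ≤ max 1 ‖α i‖ ^ (d - 1) := pow_le_pow_right₀ hm hj
        _ ≤ _ := le_mul_of_one_le_left (by positivity) (by linarith)
  have hWdet := Matrix.norm_det_le_factorial_mul_prod W _ hentry
  rw [Finset.prod_mul_distrib, Finset.prod_const, Finset.card_univ, Fintype.card_fin,
    Finset.prod_pow] at hWdet
  rw [hdet, norm_mul, norm_prod, mul_comm]
  have hprod : ∏ v, ‖if v ∈ A then α v - α (f v) else 1‖ = ∏ v ∈ A, ‖α v - α (f v)‖ := by
    rw [← Finset.prod_subset (Finset.subset_univ A)]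
    · exact Finset.prod_congr rfl fun v hv => by rw [if_pos hv]
    · intro v _ hv
      rw [if_neg hv, norm_one]
  rw [hprod]
  gcongr

/-- When `f` moves all of `A` in one direction, the matrix of row operations is triangular with unit
diagonal. -/
theorem Matrix.norm_det_vandermonde_le_of_close_of_lt {d : ℕ} (hd : 1 ≤ d) (α : Fin d → ℂ)
    (f : Fin d → Fin d) (A : Finset (Fin d))
    (hf : (∀ v ∈ A, f v < v) ∨ ∀ v ∈ A, v < f v)
    (hclose : ∀ v ∈ A, ‖α v - α (f v)‖ ≤ 1 / d) :
    ‖(Matrix.vandermonde α).det‖ ≤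
      d.factorial * ((3 * d) ^ d * (∏ v, max 1 ‖α v‖) ^ (d - 1)) *
        ∏ v ∈ A, ‖α v - α (f v)‖ := by
  refine Matrix.norm_det_vandermonde_le_of_close hd α f A ?_ hclose
  have hdiag : ∀ i, ¬ (i ∈ A ∧ i = f i) := by
    rintro i ⟨hi, he⟩
    rcases hf with h | h
    · exact (h i hi).ne he.symm
    · exact (h i hi).ne he
  rcases hf with h | h
  · rw [Matrix.det_of_isLowerTriangular]
    · simp [hdiag]
    · intro i j hij
      have hij : i < j := hij
      have : ¬ (i ∈ A ∧ j = f i) := fun ⟨hi, he⟩ => (h i hi).not_gt (he ▸ hij)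
      simp [this, hij.ne]
  · rw [Matrix.det_of_isUpperTriangular]
    · simp [hdiag]
    · intro i j hij
      have hij : j < i := hij
      have : ¬ (i ∈ A ∧ j = f i) := fun ⟨hi, he⟩ => (h i hi).not_gt (he ▸ hij)
      simp [this, hij.ne']

theorem one_le_of_abs_coeff_lt_two_pow {p : ℤ[X]} {L : ℕ} (hp : p ≠ 0)
    (hL : ∀ k, |p.coeff k| < 2 ^ L) : 1 ≤ L := by
  rcases Nat.eq_zero_or_pos L with rfl | h
  · have h1 := hL p.natDegree
    have h2 := Int.one_le_abs (leadingCoeff_ne_zero.2 hp)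
    rw [coeff_natDegree] at h1
    simp only [pow_zero] at h1
    omega
  · exact h

/-! ### Root separation -/

/-- A root separation bound of Davenport–Mahler type: an acyclic system of pairs of close roots. -/
theorem sum_neg_log_norm_sub_le {p : ℤ[X]} {d L : ℕ} {α : Fin d → ℂ} (hd1 : 1 ≤ d)
    (hd : p.natDegree = d) (hL : ∀ k, |p.coeff k| < 2 ^ L) (hinj : Function.Injective α)
    (hα : (p.map (Int.castRingHom ℂ)).roots = Finset.univ.val.map α)
    (f : Fin d → Fin d) (A : Finset (Fin d)) (hf : (∀ v ∈ A, f v < v) ∨ ∀ v ∈ A, v < f v)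
    (hclose : ∀ v ∈ A, ‖α v - α (f v)‖ ≤ 1 / d) :
    ∑ v ∈ A, -Real.log ‖α v - α (f v)‖ ≤ 5 * (d * (L + Real.log d)) := by
  have hp : p ≠ 0 := by rintro rfl; rw [natDegree_zero] at hd; omega
  have hL1 : (1 : ℝ) ≤ L := by exact_mod_cast one_le_of_abs_coeff_lt_two_pow hp hL
  have hdR : (1 : ℝ) ≤ d := by exact_mod_cast hd1
  have hpos : ∀ v ∈ A, 0 < ‖α v - α (f v)‖ := fun v hv => by
    rw [norm_pos_iff, sub_ne_zero]
    refine hinj.ne ?_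
    rcases hf with h | h
    · exact (h v hv).ne'
    · exact (h v hv).ne
  have h1 := one_le_leadingCoeff_pow_mul_sq_det_vandermonde hd hp hinj hα
  have h2 := Matrix.norm_det_vandermonde_le_of_close_of_lt hd1 α f A hf hclose
  have h3 := prod_max_one_norm_le hd hL hα
  have h4 : |(p.leadingCoeff : ℝ)| ≤ 2 ^ L := by exact_mod_cast (hL p.natDegree).le
  set a := |(p.leadingCoeff : ℝ)|
  set D := ∏ i, max 1 ‖α i‖
  set P := ∏ v ∈ A, ‖α v - α (f v)‖ with hP
  have ha : 0 ≤ a := abs_nonneg _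
  have hD : 0 ≤ D := Finset.prod_nonneg fun i _ => zero_le_one.trans (le_max_left _ _)
  have hP0 : 0 < P := Finset.prod_pos hpos
  have hfac : (d.factorial : ℝ) ≤ d ^ d := by exact_mod_cast Nat.factorial_le_pow d
  have h5 : a ^ (d - 1) * ‖(Matrix.vandermonde α).det‖ ≤
      d ^ d * ((3 * d) ^ d * ((d + 1) * 2 ^ L) ^ d) * P := by
    have hone : (1 : ℝ) ≤ (d + 1) * 2 ^ L := by
      have : (1 : ℝ) ≤ 2 ^ L := one_le_pow₀ one_le_two
      nlinarith
    calc a ^ (d - 1) * ‖(Matrix.vandermonde α).det‖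
        ≤ a ^ (d - 1) * (d.factorial * ((3 * d) ^ d * D ^ (d - 1)) * P) := by gcongr
      _ = d.factorial * ((3 * d) ^ d * (a * D) ^ (d - 1)) * P := by rw [mul_pow a D]; ring
      _ ≤ d ^ d * ((3 * d) ^ d * ((d + 1) * 2 ^ L) ^ (d - 1)) * P := by gcongr
      _ ≤ d ^ d * ((3 * d) ^ d * ((d + 1) * 2 ^ L) ^ d) * P := by
        gcongr
        omega
  -- The exponent 2d - 1 splits as 1 + 2(d - 1): each determinant takes d - 1 leading coefficients
  -- to complete its Mahler measures, and one is left over.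
  have h6 : 1 ≤ (2 : ℝ) ^ L * (d ^ d * ((3 * d) ^ d * ((d + 1) * 2 ^ L) ^ d) * P) ^ 2 := by
    calc 1 ≤ a ^ (d - 1 + d) * ‖(Matrix.vandermonde α).det‖ ^ 2 := h1
      _ = a * (a ^ (d - 1) * ‖(Matrix.vandermonde α).det‖) ^ 2 := by
        obtain ⟨e, rfl⟩ : ∃ e, d = e + 1 := ⟨d - 1, by omega⟩
        rw [Nat.add_sub_cancel]
        ring
      _ ≤ _ := by gcongr
  have h7 := Real.log_nonneg h6
  have hd0 : (d : ℝ) ≠ 0 := by positivity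
  rw [Real.log_mul (by positivity) (by positivity), Real.log_pow, Real.log_pow,
    Real.log_mul (by positivity) hP0.ne', Real.log_mul (by positivity) (by positivity),
    Real.log_mul (by positivity) (by positivity), Real.log_pow, Real.log_pow, Real.log_pow,
    Real.log_mul (by positivity) (by positivity), Real.log_mul (by positivity) (by positivity),
    Real.log_pow, hP, Real.log_prod fun v hv => (hpos v hv).ne'] at h7
  rw [Finset.sum_neg_distrib]
  have hlog2 : Real.log 2 ≤ 0.7 := by linarith [Real.log_two_lt_d9]
  have hlog3 : Real.log 3 ≤ 2 := by linarith [Real.log_le_sub_one_of_pos (x := 3) (by norm_num)]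
  have hlogd : 0 ≤ Real.log d := Real.log_nonneg hdR
  have hlogd1 : Real.log (d + 1) ≤ 0.7 + Real.log d := by
    have : Real.log (d + 1) ≤ Real.log (2 * d) := Real.log_le_log (by positivity) (by linarith)
    rw [Real.log_mul two_ne_zero hd0] at this
    linarith
  push_cast at h7
  have e1 : (L : ℝ) * Real.log 2 ≤ L * 0.7 := by gcongr
  have e2 : Real.log d + (Real.log 3 + Real.log d + (Real.log (d + 1) + L * Real.log 2)) ≤
      3 * Real.log d + 3.4 * L := by linarith
  have e3 := mul_le_mul_of_nonneg_left e2 (zero_le_one.trans hdR)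
  have e4 : (L : ℝ) ≤ d * L := le_mul_of_one_le_left (by linarith) hdR
  have e5 : 0 ≤ (d : ℝ) * Real.log d := by positivity
  nlinarith

theorem exists_separation {p : ℤ[X]} {d L : ℕ} {α : Fin d → ℂ} (hd1 : 1 ≤ d)
    (hd : p.natDegree = d) (hL : ∀ k, |p.coeff k| < 2 ^ L) (hinj : Function.Injective α)
    (hα : (p.map (Int.castRingHom ℂ)).roots = Finset.univ.val.map α) :
    ∃ σ : Fin d → ℝ, (∀ v, 0 < σ v) ∧ (∀ u v, α u ≠ α v → σ v ≤ ‖α v - α u‖) ∧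
      ∑ v, max 0 (-Real.log (σ v)) ≤ 11 * (d * (L + Real.log d)) := by
  classical
  have hdR : (1 : ℝ) ≤ d := by exact_mod_cast hd1
  have hlogd : 0 ≤ Real.log d := Real.log_nonneg hdR
  rcases hd1.eq_or_lt with rfl | hd2
  · refine ⟨fun _ => 1, fun _ => one_pos, fun u v h => absurd (congrArg α (Subsingleton.elim u v)) h,
      ?_⟩
    simp only [Real.log_one, neg_zero, max_self, Finset.sum_const_zero]
    positivity
  · have hnear : ∀ v : Fin d, ∃ u, u ≠ v ∧ ∀ w, w ≠ v → ‖α v - α u‖ ≤ ‖α v - α w‖ := fun v => by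
      have : Nontrivial (Fin d) := Fin.nontrivial_iff_two_le.2 hd2
      obtain ⟨u₀, hu₀⟩ := exists_ne v
      obtain ⟨u, hu, hmin⟩ := Finset.exists_min_image (Finset.univ.erase v)
        (fun u => ‖α v - α u‖) ⟨u₀, by simpa using hu₀⟩
      exact ⟨u, by simpa using hu, fun w hw => hmin w (by simpa using hw)⟩
    choose f hfne hfmin using hnear
    have hpos : ∀ v, 0 < ‖α v - α (f v)‖ := fun v => by
      rw [norm_pos_iff, sub_ne_zero]
      exact hinj.ne (hfne v).symm
    refine ⟨fun v => ‖α v - α (f v)‖, hpos, fun u v h => hfmin v u fun e => h (by rw [e]), ?_⟩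
    -- The nearest-neighbour map may have 2-cycles; separating the indices it lowers from those it
    -- raises gives two acyclic systems. Each costs 5, and the roots with no neighbour within 1/d
    -- add at most log d each, hence 11.
    have hb := fun A => sum_neg_log_norm_sub_le hd1 hd hL hinj hα f A
    have h1 := hb (Finset.univ.filter fun v => ‖α v - α (f v)‖ ≤ 1 / d ∧ f v < v)
      (Or.inl fun v hv => (Finset.mem_filter.1 hv).2.2) fun v hv => (Finset.mem_filter.1 hv).2.1
    have h2 := hb (Finset.univ.filter fun v => ‖α v - α (f v)‖ ≤ 1 / d ∧ v < f v)
      (Or.inr fun v hv => (Finset.mem_filter.1 hv).2.2) fun v hv => (Finset.mem_filter.1 hv).2.1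
    rw [Finset.sum_filter] at h1 h2
    have hpt : ∀ v ∈ Finset.univ, max 0 (-Real.log ‖α v - α (f v)‖) ≤ Real.log d +
        ((if ‖α v - α (f v)‖ ≤ 1 / d ∧ f v < v then -Real.log ‖α v - α (f v)‖ else 0) +
          if ‖α v - α (f v)‖ ≤ 1 / d ∧ v < f v then -Real.log ‖α v - α (f v)‖ else 0) := by
      intro v _
      by_cases hv : ‖α v - α (f v)‖ ≤ 1 / d
      · have hle : ‖α v - α (f v)‖ ≤ 1 := hv.trans (by rw [div_le_one] <;> linarith)
        have hlog : Real.log ‖α v - α (f v)‖ ≤ 0 := Real.log_nonpos (norm_nonneg _) hle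
        rw [max_eq_right (by linarith)]
        rcases (hfne v).lt_or_gt with h | h
        · simp only [hv, h, h.not_gt, and_self, and_false, if_true, if_false]; linarith
        · simp only [hv, h, h.not_gt, and_self, and_false, if_true, if_false]; linarith
      · have hlog : Real.log (1 / d) ≤ Real.log ‖α v - α (f v)‖ :=
          Real.log_le_log (by positivity) (not_le.1 hv).le
        rw [one_div, Real.log_inv] at hlog
        simp only [hv, false_and, if_false, add_zero]
        exact max_le hlogd (by linarith)
    have h3 := Finset.sum_le_sum hpt
    rw [Finset.sum_add_distrib, Finset.sum_add_distrib, Finset.sum_const, Finset.card_univ,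
      Fintype.card_fin, nsmul_eq_mul] at h3
    have h4 : 0 ≤ (d : ℝ) * L := by positivity
    linarith

/-! ### The bound on the benchmark square -/

theorem splitDepth_two_pow_le (L : ℕ) {s : ℝ} (hs : 0 < s) :
    splitDepth (2 ^ (L + 1)) s ≤ L + 3 + 2 * max 0 (-Real.log s) := by
  have h0 : 0 ≤ max 0 (-Real.log s) := le_max_left _ _
  refine max_le (by positivity) ?_
  rw [show (4 : ℝ) * 2 ^ (L + 1) = 2 ^ (L + 3) by ring, Real.logb, Real.log_div (by positivity) hs.ne',
    Real.log_pow, div_le_iff₀ (Real.log_pos one_lt_two)]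
  have h1 : -Real.log s ≤ max 0 (-Real.log s) := le_max_right _ _
  have h2 : 1 ≤ 2 * Real.log 2 := by linarith [Real.log_two_gt_d9]
  push_cast
  nlinarith [mul_le_mul_of_nonneg_left h2 h0]

/-- The size bound for every bisection predicate that accepts the closed squares with at most one
root. -/
theorem exists_subdivisionTree_benchmark_size_le {p : ℤ[X]} {d L : ℕ} (hd1 : 1 ≤ d)
    (hd : p.natDegree = d) (hsq : Squarefree (p.map (Int.castRingHom ℚ)))
    (hL : ∀ k, |p.coeff k| < 2 ^ L) {B : Square → Prop} (hB : ∀ S, CSturmClosed p S → B S) :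
    ∃ T : QuadTree, SubdivisionTree B (Square.benchmark L) T ∧
      (T.size : ℝ) ≤ 417 * (d * (L + Real.log d)) := by
  have hp : p ≠ 0 := by rintro rfl; rw [natDegree_zero] at hd; omega
  have hnodup : (p.map (Int.castRingHom ℂ)).roots.Nodup := by
    have hsep := (PerfectField.separable_iff_squarefree.2 hsq).map (f := algebraMap ℚ ℂ)
    rw [map_map, RingHom.ext_int ((algebraMap ℚ ℂ).comp (Int.castRingHom ℚ)) (Int.castRingHom ℂ)]
      at hsep
    exact nodup_roots hsep
  obtain ⟨α, hinj, hα⟩ := exists_injective_enumeration_of_nodup (d := d) hnodup (by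
    rw [← (IsAlgClosed.splits _).natDegree_eq_card_roots,
      natDegree_map_eq_of_injective Int.cast_injective, hd])
  have hrange : p.rootSet ℂ = Set.range α := by
    ext z
    rw [rootSet, Finset.mem_coe, Multiset.mem_toFinset, aroots, algebraMap_int_eq, hα]
    simp
  obtain ⟨σ, hσ, hsep, hsum⟩ := exists_separation hd1 hd hL hinj hα
  have hterm : ∃ n : ℕ, ∀ v, 2 * (Square.benchmark L).w < 2 ^ n * σ v := by
    have : ∀ v, ∃ n : ℕ, 2 * (Square.benchmark L).w / σ v < 2 ^ n := fun v =>
      pow_unbounded_of_one_lt _ one_lt_two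
    choose n hn using this
    refine ⟨Finset.univ.sup n, fun v => ?_⟩
    rw [← div_lt_iff₀ (hσ v)]
    exact (hn v).trans_le (pow_le_pow_right₀ one_le_two (Finset.le_sup (Finset.mem_univ v)))
  obtain ⟨n, hn⟩ := hterm
  obtain ⟨T, hT, hsize⟩ := exists_subdivisionTree_size_le α σ hσ hsep B
    (fun S hS => hB S (by rwa [CSturmClosed, hrange])) n _ hn
  refine ⟨T, hT, hsize.trans ?_⟩
  have hle : ∑ v, (Square.benchmark L).multiplicity (α v) *
      splitDepth (Square.benchmark L).w (σ v) ≤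
      ∑ v, 4 * (L + 3 + 2 * max 0 (-Real.log (σ v))) :=
    Finset.sum_le_sum fun v _ => mul_le_mul (Square.multiplicity_le_four _ _)
      (splitDepth_two_pow_le L (hσ v)) (splitDepth_nonneg _ _) (by norm_num)
  rw [← Finset.mul_sum, Finset.sum_add_distrib, Finset.sum_const, Finset.card_univ,
    Fintype.card_fin, nsmul_eq_mul, ← Finset.mul_sum] at hle
  have hL1 : (1 : ℝ) ≤ L := by exact_mod_cast one_le_of_abs_coeff_lt_two_pow hp hL
  have hdR : (1 : ℝ) ≤ d := by exact_mod_cast hd1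
  have h1 : 0 ≤ (d : ℝ) * Real.log d := mul_nonneg (by linarith) (Real.log_nonneg hdR)
  have h2 : 1 * 1 ≤ (d : ℝ) * L := mul_le_mul hdR hL1 zero_le_one (by linarith)
  have h3 : (d : ℝ) * 1 ≤ d * L := mul_le_mul_of_nonneg_left hL1 (by linarith)
  -- The constant is 417 = 1 + 16 · (4 + 2 · 11), with 16 the multiplicity bound 4 times the 4
  -- children, and L + 3 ≤ 4L.
  linarith

theorem CSturmClosed.cSturm {p : ℤ[X]} {S : Square} (h : CSturmClosed p S) : CSturm p S :=
  (Set.ncard_le_ncard (Set.inter_subset_inter_right _ S.halfOpenRegion_subset_closedRegion)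
    ((rootSet_finite p ℂ).inter_of_left _)).trans h

theorem mainTheorem5 :
    ∃ C : ℝ, ∀ (d L : ℕ) (p : ℤ[X]), 1 ≤ d → p.natDegree = d →
      Squarefree (p.map (Int.castRingHom ℚ)) → (∀ k, |p.coeff k| < 2 ^ L) →
      (∃ T : QuadTree, SubdivisionTree (CSturm p) (Square.benchmark L) T ∧
        (T.size : ℝ) ≤ C * (d * (L + Real.log d))) ∧
      (∃ T : QuadTree, SubdivisionTree (CSturmClosed p) (Square.benchmark L) T ∧
        (T.size : ℝ) ≤ C * (d * (L + Real.log d))) :=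
  ⟨417, fun _ _ _ hd1 hd hsq hL =>
    ⟨exists_subdivisionTree_benchmark_size_le hd1 hd hsq hL fun _ => CSturmClosed.cSturm,
      exists_subdivisionTree_benchmark_size_le hd1 hd hsq hL fun _ => id⟩⟩
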